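/- For words over the binary alphabet $\Sigma=\{0,1\}$, "$y$ is obtained from $x$ by $i$ insertions and $d$ deletions" means that single symbols are inserted and deleted at arbitrary positions and in any order, $i$ insertions and $d$ deletions in total. A code of length $n$ is a set $C\subseteq\Sigma^n$. It is *$2$-deletion-correcting* if no word can be obtained from two distinct codewords by at most two deletions from each. For real $\tau_I,\tau_D\ge 0$ and an integer $L\ge1$, $C$ is *$(\tau_I,\tau_D,L)$-insdel-list-decodable* if for every integer $N\ge 0$ with $n-\tau_D n\le N\le n+\tau_I n$ and every word $y\in\Sigma^N$ there are at most $L$ codewords of $C$ that can be obtained from $y$ by at most $\tau_D n$ insertions and at most $\tau_I n$ deletions. For real $\delta, x$ put $$\rho^{(\delta,L)}(x)=\max_{r=1,\dots,L}\left\{\frac{2L-r+1}{L+1}\,x-\frac{L}{r}\,(1-\delta)\right\}.$$ **Theorem.** Let $C\subseteq\{0,1\}^n$, $n\ge1$, be a $2$-deletion-correcting code of length $n$ (for instance the Guruswami–Håstad two-deletion code of length $n$), let $L\ge1$ be an integer (the bound is of interest for $L=\Omega(n)$, but no lower bound on $L$ is needed), and let $\tau_I,\tau_D\ge0$ be real numbers.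 If $$\tau_D<\frac3n\qquad\text{and}\qquad \tau_I<\rho^{(3/n,\,L)}(1-\tau_D),$$ then $C$ is $(\tau_I,\tau_D,L)$-insdel-list-decodable. -/

import Mathlib

namespace InsdelCodes

/-- `Obtainable x i d y`: the word `y` can be obtained from the word `x` by inserting exactly `i`
symbols and deleting exactly `d` symbols, one at a time, at arbitrary positions and in any order. -/
inductive Obtainable {α : Type} (x : List α) : ℕ → ℕ → List α → Prop
  | refl : Obtainable x 0 0 x
  | ins {i d : ℕ} {u v : List α} (s : α) :
      Obtainable x i d (u ++ v) → Obtainable x (i + 1) d (u ++ s :: v)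
  | del {i d : ℕ} {u v : List α} (s : α) :
      Obtainable x i d (u ++ s :: v) → Obtainable x i (d + 1) (u ++ v)

/-- The insdel ball with centre `x`, insertion radius `tI` and deletion radius `tD`. The radii are
real numbers, since they have the form `τ * n`. -/
def insdelBall {α : Type} (x : List α) (tI tD : ℝ) : Set (List α) :=
  {y | ∃ i d : ℕ, (i : ℝ) ≤ tI ∧ (d : ℝ) ≤ tD ∧ Obtainable x i d y}

/-- A set of words is a (block) code of length `n` if all its words have length `n`. -/
def IsCodeOfLength {α : Type} (C : Set (List α)) (n : ℕ) : Prop :=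
  ∀ c ∈ C, c.length = n

/-- A code corrects `s` deletions if a word that is left over after at most `s` deletions
comes from at most one codeword. -/
def IsDeletionCorrecting {α : Type} (C : Set (List α)) (s : ℕ) : Prop :=
  ∀ c ∈ C, ∀ c' ∈ C, ∀ (z : List α) (d d' : ℕ), d ≤ s → d' ≤ s →
    Obtainable c 0 d z → Obtainable c' 0 d' z → c = c'

/-- A code `C` of length `n` is `(τI, τD, L)`-insdel-list-decodable: for every received word `y`
of length `N` with `n - τD n ≤ N ≤ n + τI n`, at most `L` codewords can be recovered from `y`
by at most `τD n` insertions and at most `τI n` deletions (which undo the errors). -/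
def IsInsdelListDecodable {α : Type} (C : Set (List α)) (n : ℕ) (τI τD : ℝ) (L : ℕ) : Prop :=
  ∀ N : ℕ, (n : ℝ) - τD * n ≤ N → (N : ℝ) ≤ n + τI * n →
    ∀ y : List α, y.length = N →
      (insdelBall y (τD * n) (τI * n) ∩ C).encard ≤ L

/-- `ρ^{(δ,L)}(x) = max_{r = 1, …, L} ((2L - r + 1)/(L + 1) * x - (L / r) * (1 - δ))`. -/
noncomputable def rho (δ : ℝ) (L : ℕ) (hL : 1 ≤ L) (x : ℝ) : ℝ :=
  (Finset.Icc 1 L).sup' (Finset.nonempty_Icc.mpr hL) fun r : ℕ =>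
    (2 * (L : ℝ) - r + 1) / ((L : ℝ) + 1) * x - (L : ℝ) / r * (1 - δ)

end InsdelCodes

/-!
A word `c` obtained from the received word `y` by `i` insertions and `d` deletions leaves a trace
in `y`: the set `A c` of those positions of `y` that are never deleted. This set misses at most `d`
positions of `y`, and the letters of `y` at these positions form a subword of `c` that misses at
most `i` letters of `c` (`Obtainable.exists_common_sublist`). For two codewords, the letters at
`A c ∩ A c'` form a common subword of both, so `|A c ∩ A c'| ≤ n - 3` in a code that corrects two
deletions.

If there were `L + 1` such codewords, their traces would be `L + 1` large subsets of the positions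
of `y` with small pairwise intersections, and double counting (`card_lower_bound_of_inter_le`)
bounds the size of the complements from below. Let `m x` be the number of traces that
contain the position `x`. The sum of `L + 1 - m x` over all positions is the total size of the
complements, the sum of `m x` is the total size of the traces, and the sum of `m x * (m x - 1)` is
the total size of the intersections of pairs. The three are compared by a quadratic
inequality which holds for every integer `m` and every `r` in the range of the maximum
(`mul_le_sub_add_of_int`); it is tight at `m = L` and `m = L + 1` when `r = L`.
-/

namespace InsdelCodes

/-! ### Subwords and positions -/

/-- Deleting letters only from the part `l` of a word `p ++ l` yields every word `p ++ z`
with `z` a subword of `l`. -/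
theorem Obtainable.delete_sublist {α : Type} {x l z : List α} (h : z.Sublist l) :
    ∀ {p : List α} {i d : ℕ}, Obtainable x i d (p ++ l) →
      Obtainable x i (d + (l.length - z.length)) (p ++ z) := by
  induction h with
  | slnil => intro p i d hx; simpa using hx
  | @cons z l s hzl ih =>
    intro p i d hx
    have hlen := hzl.length_le
    have := ih hx.del
    rwa [show d + 1 + (l.length - z.length) = d + ((s :: l).length - z.length) by
      simp only [List.length_cons]; omega] at this
  | @cons_cons z l s hzl ih =>
    intro p i d hx
    have := ih (p := p ++ [s]) (i := i) (d := d) (by simpa using hx)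
    simpa using this

theorem obtainable_of_sublist {α : Type} {c z : List α} (h : z.Sublist c) :
    Obtainable c 0 (c.length - z.length) z := by
  simpa using Obtainable.delete_sublist h (p := []) (Obtainable.refl (x := c))

/-- A word obtained by `i` insertions and `d` deletions shares with the original word
the subword of those original letters that are never deleted. -/
theorem Obtainable.exists_common_sublist {α : Type} {y c : List α} {i d : ℕ}
    (h : Obtainable y i d c) :
    ∃ w : List α, w.Sublist y ∧ w.Sublist c ∧
      y.length ≤ w.length + d ∧ c.length ≤ w.length + i := by
  induction h with
  | refl => exact ⟨y, List.Sublist.refl _, List.Sublist.refl _, by simp, by simp⟩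
  | @ins i d u v s _ ih =>
    obtain ⟨w, hy, hc, h1, h2⟩ := ih
    refine ⟨w, hy, hc.trans (by simp), h1, ?_⟩
    simp only [List.length_append, List.length_cons] at h2 ⊢
    omega
  | @del i d u v s _ ih =>
    obtain ⟨w, hy, hc, h1, h2⟩ := ih
    obtain ⟨w₁, w₂, rfl, hw₁, hw₂⟩ := List.sublist_append_iff.mp hc
    rcases List.sublist_cons_iff.mp hw₂ with hv | ⟨t, rfl, ht⟩
    · refine ⟨w₁ ++ w₂, hy, hw₁.append hv, by omega, ?_⟩
      simp only [List.length_append, List.length_cons] at h2 ⊢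
      omega
    · refine ⟨w₁ ++ t, (by simp : (w₁ ++ t).Sublist (w₁ ++ s :: t)).trans hy,
        hw₁.append ht, ?_, ?_⟩ <;>
      · simp only [List.length_append, List.length_cons] at h1 h2 ⊢
        omega

/-- The subword of `y` formed by the letters at the positions in `S`. -/
def subword {α : Type} (y : List α) (S : Finset (Fin y.length)) : List α :=
  ((List.finRange y.length).filter (· ∈ S)).map y.get

theorem length_subword {α : Type} (y : List α) (S : Finset (Fin y.length)) :
    (subword y S).length = S.card := by
  rw [subword, List.length_map,
    ← List.toFinset_card_of_nodup ((List.nodup_finRange _).filter _)]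
  congr 1
  ext a
  simp

theorem subword_sublist_subword {α : Type} (y : List α) {S T : Finset (Fin y.length)}
    (h : S ⊆ T) : (subword y S).Sublist (subword y T) := by
  refine List.Sublist.map _ (List.monotone_filter_right _ fun a ha => ?_)
  simpa using h (by simpa using ha)

theorem exists_subword_eq {α : Type} {w y : List α} (h : w.Sublist y) :
    ∃ S : Finset (Fin y.length), subword y S = w := by
  obtain ⟨l, hl, rfl⟩ : ∃ l : List (Fin y.length), l.Sublist (List.finRange y.length) ∧ w = l.map y.get := by
    rw [← List.sublist_map_iff]
    simpa using h
  refine ⟨l.toFinset, ?_⟩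
  have hnd : l.Nodup := hl.nodup (List.nodup_finRange _)
  have hlt : (List.finRange y.length).Pairwise (· < ·) := List.pairwise_lt_finRange _
  -- Both lists are strictly increasing with the same members.
  have : (List.finRange y.length).filter (· ∈ l.toFinset) = l := by
    refine List.Perm.eq_of_pairwise (le := (· < ·)) (fun a b _ _ h₁ h₂ => absurd h₁ h₂.asymm)
      (hlt.filter _) (hlt.sublist hl) ?_
    rw [List.perm_ext_iff_of_nodup ((List.nodup_finRange _).filter _) hnd]
    simp
  rw [subword, this]

/-! ### Set systems with small pairwise intersections -/

/-- In terms of `k = m - r` and `b = L - r`, the difference of the two sides, multiplied by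
`r (L + 1)`, is `(r + b + 1) k (k - 1) - r b (k - b - 1)`. This is nonnegative as `k` is an
integer. -/
theorem mul_le_sub_add_of_int {L r : ℕ} (hr : 1 ≤ r) (hrL : r ≤ L) (m : ℤ) :
    (2 * (L : ℝ) - r + 1) / (L + 1) * m ≤ (L + 1 - m) + (m * m - m) / r := by
  obtain ⟨b, rfl⟩ := Nat.exists_eq_add_of_le hrL
  obtain ⟨k, rfl⟩ : ∃ k : ℤ, m = r + k := ⟨m - r, by ring⟩
  have key : (0 : ℤ) ≤ (r + b + 1) * (k * (k - 1)) - r * b * (k - b - 1) := by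
    have hkk : 0 ≤ k * (k - 1) := by
      rcases le_or_gt k 0 with h | h <;> nlinarith
    rcases le_or_gt k (b + 1) with h | h
    · have : (0 : ℤ) ≤ r * b * (b + 1 - k) := mul_nonneg (by positivity) (by linarith)
      have : (0 : ℤ) ≤ (r + b + 1) * (k * (k - 1)) := mul_nonneg (by positivity) hkk
      linarith
    · have h1 : (b : ℤ) * (k - b - 1) ≤ k * (k - 1) :=
        mul_le_mul (by linarith) (by linarith) (by linarith) (by linarith)
      have h2 : (r : ℤ) * (b * (k - b - 1)) ≤ r * (k * (k - 1)) :=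
        mul_le_mul_of_nonneg_left h1 (by positivity)
      have : (0 : ℤ) ≤ (b + 1) * (k * (k - 1)) := mul_nonneg (by positivity) hkk
      linarith
  have key' : (0 : ℝ) ≤ (r + b + 1) * (k * (k - 1)) - r * b * (k - b - 1) := by
    exact_mod_cast key
  have hr0 : (0 : ℝ) < r := by exact_mod_cast hr
  have hL0 : (0 : ℝ) < r + b + 1 := by positivity
  rw [← sub_nonneg]
  push_cast
  have : ((r : ℝ) + b + 1 - (r + k)) + ((r + k) * (r + k) - (r + k)) / r
      - (2 * ((r : ℝ) + b) - r + 1) / (r + b + 1) * (r + k)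
      = ((r + b + 1) * (k * (k - 1)) - r * b * (k - b - 1)) / (r * (r + b + 1)) := by
    field_simp
    ring
  rw [this]
  positivity

/-- If `L + 1` sets have size at least `a`, pairwise intersections of size at most `b`
and complements of size at most `D`, then `D` is bounded from below in terms of `a` and `b`. -/
theorem card_lower_bound_of_inter_le {ι X : Type*} [DecidableEq ι] [Fintype X] [DecidableEq X]
    (T : Finset ι) (A : ι → Finset X) {L r : ℕ} (hT : T.card = L + 1) (hr : 1 ≤ r) (hrL : r ≤ L)
    {a b D : ℝ} (ha : ∀ c ∈ T, a ≤ (A c).card)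
    (hD : ∀ c ∈ T, (Fintype.card X : ℝ) - (A c).card ≤ D)
    (hb : ∀ c ∈ T, ∀ c' ∈ T, c ≠ c' → ((A c ∩ A c').card : ℝ) ≤ b) :
    (2 * (L : ℝ) - r + 1) / (L + 1) * a - L / r * b ≤ D := by
  have hr0 : (0 : ℝ) < r := by exact_mod_cast hr
  have hrL' : (r : ℝ) ≤ L := by exact_mod_cast hrL
  have hTR : (T.card : ℝ) = L + 1 := by rw [hT]; push_cast; rfl
  -- The number of sets that contain a given point.
  let m : X → ℕ := fun x => (T.filter fun c => x ∈ A c).card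
  have hcard : ∀ S : Finset X, (S.card : ℝ) = ∑ x, if x ∈ S then (1 : ℝ) else 0 := fun S => by
    simp
  have hm : ∀ x, (m x : ℝ) = ∑ c ∈ T, if x ∈ A c then (1 : ℝ) else 0 := fun x => by
    simp [m]
  have hS1 : ∑ x, (m x : ℝ) = ∑ c ∈ T, ((A c).card : ℝ) := by
    simp_rw [hm, hcard]
    exact Finset.sum_comm
  have hS2 : ∑ x, (m x : ℝ) * m x = ∑ c ∈ T, ∑ c' ∈ T, ((A c ∩ A c').card : ℝ) := by
    simp_rw [hm, hcard, Finset.sum_mul_sum]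
    rw [Finset.sum_comm]
    refine Finset.sum_congr rfl fun c _ => ?_
    rw [Finset.sum_comm]
    refine Finset.sum_congr rfl fun c' _ => Finset.sum_congr rfl fun x _ => ?_
    by_cases h : x ∈ A c <;> by_cases h' : x ∈ A c' <;> simp [h, h']
  have hpairs : ∑ x, ((m x : ℝ) * m x - m x) ≤ (L + 1) * (L * b) := by
    rw [Finset.sum_sub_distrib, hS1, hS2, ← Finset.sum_sub_distrib, ← hTR, ← nsmul_eq_mul]
    refine Finset.sum_le_card_nsmul _ _ _ fun c hc => ?_
    rw [← Finset.add_sum_erase _ _ hc, Finset.inter_self, add_sub_cancel_left]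
    have hce : ((T.erase c).card : ℝ) = L := by
      rw [Finset.card_erase_of_mem hc, hT, Nat.add_sub_cancel]
    rw [← hce, ← nsmul_eq_mul]
    refine Finset.sum_le_card_nsmul _ _ _ fun c' hc' => ?_
    exact hb c hc c' (Finset.mem_of_mem_erase hc') (Finset.ne_of_mem_erase hc').symm
  have hlow : (L + 1) * a ≤ ∑ x, (m x : ℝ) := by
    rw [hS1, ← hTR, ← nsmul_eq_mul]
    exact Finset.card_nsmul_le_sum _ _ _ ha
  have hcompl : ∑ x, ((L : ℝ) + 1 - m x) ≤ (L + 1) * D := by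
    have : ∑ x, ((L : ℝ) + 1 - m x) = ∑ c ∈ T, ((Fintype.card X : ℝ) - (A c).card) := by
      rw [Finset.sum_sub_distrib, Finset.sum_sub_distrib, hS1]
      simp only [Finset.sum_const, nsmul_eq_mul, hTR, Finset.card_univ]
      ring
    rw [this, ← hTR, ← nsmul_eq_mul]
    exact Finset.sum_le_card_nsmul _ _ _ hD
  have hpt := Finset.sum_le_sum fun x (_ : x ∈ Finset.univ) =>
    mul_le_sub_add_of_int hr hrL (m x : ℤ)
  simp only [Int.cast_natCast] at hpt
  rw [← Finset.mul_sum, Finset.sum_add_distrib, ← Finset.sum_div] at hpt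
  have hcoef : 0 ≤ (2 * (L : ℝ) - r + 1) / (L + 1) := div_nonneg (by linarith) (by positivity)
  have h1 := mul_le_mul_of_nonneg_left hlow hcoef
  have h2 := div_le_div_of_nonneg_right hpairs hr0.le
  have hL0 : (0 : ℝ) < L + 1 := by positivity
  refine le_of_mul_le_mul_left ?_ hL0
  calc ((L : ℝ) + 1) * ((2 * (L : ℝ) - r + 1) / (L + 1) * a - L / r * b)
      = (2 * (L : ℝ) - r + 1) / (L + 1) * ((L + 1) * a) - (L + 1) * (L * b) / r := by ring
    _ ≤ (L + 1) * D := by linarith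

/-! ### List decoding -/

/-- Two distinct codewords of a code that corrects `s` deletions have no common subword
that misses at most `s` letters. -/
theorem IsDeletionCorrecting.length_lt_of_sublist {α : Type} {C : Set (List α)} {n s : ℕ}
    (hC : IsCodeOfLength C n) (hdel : IsDeletionCorrecting C s) {c c' z : List α}
    (hc : c ∈ C) (hc' : c' ∈ C) (hne : c ≠ c') (hz : z.Sublist c) (hz' : z.Sublist c') :
    z.length + s < n := by
  by_contra! h
  have := hC c hc
  have := hC c' hc'
  exact hne (hdel c hc c' hc' z _ _ (by omega) (by omega)
    (obtainable_of_sublist hz) (obtainable_of_sublist hz'))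

end InsdelCodes

open InsdelCodes

theorem theorem9 (n : ℕ) (hn : 0 < n) (C : Set (List (Fin 2)))
    (hC : InsdelCodes.IsCodeOfLength C n) (hdel : InsdelCodes.IsDeletionCorrecting C 2)
    (L : ℕ) (hL : 1 ≤ L) (τI τD : ℝ) (hI : 0 ≤ τI) (hD : 0 ≤ τD)
    (hτD : τD < 3 / (n : ℝ)) (hτI : τI < InsdelCodes.rho (3 / (n : ℝ)) L hL (1 - τD)) :
    InsdelCodes.IsInsdelListDecodable C n τI τD L := by
  intro N _ _ y _
  have hn0 : (0 : ℝ) < n := by exact_mod_cast hn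
  by_contra! hlt
  obtain ⟨T', hT'sub, hT'card⟩ := Set.exists_subset_encard_eq (Order.add_one_le_of_lt hlt)
  have hfin : T'.Finite := Set.finite_of_encard_eq_coe (k := L + 1) (by simpa using hT'card)
  obtain ⟨T, rfl⟩ := hfin.exists_finset_coe
  have hT : T.card = L + 1 := by
    rw [Set.encard_coe_eq_coe_finsetCard] at hT'card
    exact_mod_cast hT'card
  have htrace : ∀ c : List (Fin 2), ∃ S : Finset (Fin y.length), c ∈ T →
      (subword y S).Sublist c ∧ (n : ℝ) * (1 - τD) ≤ S.card ∧
        (Fintype.card (Fin y.length) : ℝ) - S.card ≤ τI * n := by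
    intro c
    by_cases hcT : c ∈ T
    · obtain ⟨⟨i, d, hi, hd, hobt⟩, hcC⟩ := hT'sub hcT
      obtain ⟨w, hwy, hwc, h1, h2⟩ := hobt.exists_common_sublist
      obtain ⟨S, rfl⟩ := exists_subword_eq hwy
      rw [length_subword] at h1 h2
      rw [hC c hcC] at h2
      have h1' : (y.length : ℝ) ≤ S.card + d := by exact_mod_cast h1
      have h2' : (n : ℝ) ≤ S.card + i := by exact_mod_cast h2
      refine ⟨S, fun _ => ⟨hwc, by linarith, ?_⟩⟩
      rw [Fintype.card_fin]
      linarith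
    · exact ⟨∅, fun h => absurd h hcT⟩
  choose A hA using htrace
  obtain ⟨r, hr, hrho⟩ := (Finset.lt_sup'_iff _).mp hτI
  obtain ⟨hr1, hrL⟩ := Finset.mem_Icc.mp hr
  have hinter : ∀ c ∈ T, ∀ c' ∈ T, c ≠ c' → ((A c ∩ A c').card : ℝ) ≤ n - 3 := by
    intro c hc c' hc' hne
    have h := hdel.length_lt_of_sublist hC (hT'sub hc).2 (hT'sub hc').2 hne
      ((subword_sublist_subword y Finset.inter_subset_left).trans (hA c hc).1)
      ((subword_sublist_subword y Finset.inter_subset_right).trans (hA c' hc').1)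
    rw [length_subword] at h
    have : (((A c ∩ A c').card + 3 : ℕ) : ℝ) ≤ n := by exact_mod_cast h
    push_cast at this
    linarith
  have hbound := card_lower_bound_of_inter_le T A hT hr1 hrL
    (fun c hc => (hA c hc).2.1) (fun c hc => (hA c hc).2.2) hinter
  have hscale := mul_lt_mul_of_pos_right hrho hn0
  have hdelta : (1 - 3 / (n : ℝ)) * n = n - 3 := by field_simp
  have : ((2 * (L : ℝ) - r + 1) / ((L : ℝ) + 1) * (1 - τD) - (L : ℝ) / r * (1 - 3 / (n : ℝ))) * n
      = (2 * (L : ℝ) - r + 1) / (L + 1) * (n * (1 - τD)) - L / r * (n - 3) := by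
    rw [← hdelta]
    ring
  linarith
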